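/- Let $\mathcal A=\{a_1<\dots<a_d\}$ be a finite ordered alphabet, $\pi$ a permutation of $\mathcal A$, and $(I_a)_{a\in\mathcal A}$ a partition of an interval $I=[\ell,r)$ into non-empty left-closed right-open intervals with $I_a$ to the left of $I_b$ when $a<b$. Let $T:I\to I$ be the associated interval exchange transformation: $T(x)=x+\tau_a$ for $x\in I_a$, where $\tau_a=\sum_{\pi^{-1}(b)<\pi^{-1}(a)}|I_b|-\sum_{b<a}|I_b|$. Assume that $T$ is regular (satisfies the Keane condition): the orbits $\{T^k(x) : k\in\mathbb Z\}$ of the left end points $x\neq\ell$ of the intervals $I_a$ are infinite and pairwise disjoint. Let $\mathcal L(T)$ be the set of all finite factors of the trajectories $w_0w_1w_2\cdots$ of the points $x\in I$, where $w_k=a$ if $T^k(x)\in I_a$. Then for every $w\in\mathcal L(T)$, every return word $u$ to $w$ in $\mathcal L(T)$ (that is, every non-empty word $u$ such that $wu\in\mathcal L(T)$ and $wu$ contains exactly two occurrences of $w$, one as a prefix and one as a suffix) is a clustering word for the ordered alphabet $\mathcal A$. That is, there is a permutation $\sigma$ of $\{1,\dots,d\}$ such that the Burrows–Wheeler transform of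 $u$ (the word formed by the last letters of the $|u|$ conjugates of $u$, sorted lexicographically with respect to the order of $\mathcal A$) equals $a_{\sigma(1)}^{k_1}a_{\sigma(2)}^{k_2}\cdots a_{\sigma(d)}^{k_d}$, where $k_i\ge 0$ is the number of occurrences of $a_{\sigma(i)}$ in $u$. -/

import Mathlib

/-- The data of an interval exchange transformation over the finite ordered alphabet `A`: the left
end point of its domain, the (positive) length of the interval of each letter, and a permutation
of the alphabet. -/
structure IET (A : Type*) where
  /-- left end point of the domain -/
  origin : ℝ
  /-- length of the interval of each letter -/
  len : A → ℝ
  len_pos : ∀ a, 0 < len a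
  /-- the permutation: the letter `perm a` takes, after the exchange, the place that `a` has in
  the order of the alphabet -/
  perm : Equiv.Perm A

namespace IET

variable {A : Type*} [Fintype A] [LinearOrder A]

/-- The domain `[ℓ, r)`, where `r - ℓ` is the sum of the lengths. -/
def domain (T : IET A) : Set ℝ :=
  Set.Ico T.origin (T.origin + ∑ a, T.len a)

/-- The left end point of the interval `I_a`. -/
def left (T : IET A) (a : A) : ℝ :=
  T.origin + ∑ b with b < a, T.len b

/-- The interval `I_a`. -/
def interval (T : IET A) (a : A) : Set ℝ :=
  Set.Ico (T.left a) (T.left a + T.len a)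

/-- The translation `τ_a` applied on `I_a`. -/
def shift (T : IET A) (a : A) : ℝ :=
  ∑ b with T.perm.symm b < T.perm.symm a, T.len b - ∑ b with b < a, T.len b

/-- The transformation: `x ↦ x + τ_a` for `x ∈ I_a`. (Outside the domain it is the identity.) -/
noncomputable def map (T : IET A) (x : ℝ) : ℝ :=
  x + ∑ a, (T.interval a).indicator (fun _ => T.shift a) x

/-- The two-sided orbit `{T ^ k x | k ∈ ℤ}` of a point `x` of the domain, as the set of the points
of the domain that are reached from `x`, or from which `x` is reached, by iterating the
transformation (which is a bijection of the domain). -/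
def orbit (T : IET A) (x : ℝ) : Set ℝ :=
  {y | y ∈ T.domain ∧ ∃ n : ℕ, T.map^[n] x = y ∨ T.map^[n] y = x}

/-- The formal discontinuities: the left end points of the intervals `I_a`, except the left end
point of the domain. -/
def discontinuities (T : IET A) : Set ℝ :=
  Set.range T.left \ {T.origin}

/-- Regularity (Keane's condition): the orbits of the formal discontinuities are infinite and
pairwise disjoint. -/
def IsRegular (T : IET A) : Prop :=
  (∀ x ∈ T.discontinuities, (T.orbit x).Infinite) ∧
    T.discontinuities.PairwiseDisjoint T.orbit

/-- The infinite word `s` is the trajectory of the point `x`: `s k = a` iff `T ^ k x ∈ I_a`. -/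
def IsTrajectory (T : IET A) (x : ℝ) (s : ℕ → A) : Prop :=
  ∀ k a, s k = a ↔ T.map^[k] x ∈ T.interval a

/-- The language: all finite factors of the trajectories of the points of the domain. -/
def language (T : IET A) : Set (List A) :=
  {v | ∃ x ∈ T.domain, ∃ s : ℕ → A, T.IsTrajectory x s ∧
    ∃ n : ℕ, v = (List.range v.length).map fun i => s (n + i)}

end IET

/-- The (right) return words to `w` in the language `L`: the nonempty words `u` such that
`w ++ u ∈ L` has exactly two occurrences of `w`, one as a prefix and one as a suffix. -/
def returnWords {A : Type*} (L : Set (List A)) (w : List A) : Set (List A) :=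
  {u | u ≠ [] ∧ w ++ u ∈ L ∧ w <:+ w ++ u ∧
    ¬ ∃ p q : List A, p ≠ [] ∧ q ≠ [] ∧ w ++ u = p ++ w ++ q}

/-- The Burrows-Wheeler transform: sort the `|w|` conjugates (rotations) of `w`, with
multiplicity, lexicographically and read off their last letters. -/
def bwt {A : Type*} [LinearOrder A] (w : List A) : List A :=
  (((List.range w.length).map w.rotate).mergeSort (fun u v => decide (u ≤ v))).filterMap
    List.getLast?

/-- `w` is `σ`-clustering: its Burrows-Wheeler transform is `σ(a₁)^{k₁} ⋯ σ(a_d)^{k_d}` where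
`a₁ < ⋯ < a_d` are the letters of the alphabet and `kᵢ` is the number of occurrences of `σ(aᵢ)`
in `w`. -/
def IsPermClustering {A : Type*} [Fintype A] [LinearOrder A]
    (σ : Equiv.Perm A) (w : List A) : Prop :=
  bwt w = (Finset.univ.sort (fun a b : A => a ≤ b)).flatMap
    fun a => List.replicate (w.count (σ a)) (σ a)

/-- `w` is clustering for the ordered alphabet `A`: it is `σ`-clustering for some `σ`. -/
def IsClustering {A : Type*} [Fintype A] [LinearOrder A] (w : List A) : Prop :=
  ∃ σ : Equiv.Perm A, IsPermClustering σ w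

/-!
The return word `u` is clustering for the permutation `T.perm` itself. Two facts carry the proof.

*Order condition* (`IET.perm_symm_le_of_itinerary`). If two points with first letters `a`, `b`
follow the same itinerary `v` after their first step and then enter `I_c`, `I_d` with `c < d`, then
`T.perm.symm a ≤ T.perm.symm b`: the two points are moved by the same translation along `v`, so
their images under `T` are in the same order as `I_c` and `I_d`, and `T` lays out the images of the
intervals in the order of `T.perm.symm`.

*Factors of the periodic word* (`window_of_agree`). The word `w ++ u` has period `|u|`, since `w`
is both a prefix and a suffix of it, so it is a window of the bi-infinite repetition of `u`, in
which `w` occurs exactly once per period. Let `a v c` and `b v d` be factors of the repetition with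
`a ≠ b`. The word `v` cannot contain `w`, as otherwise the two factors would start at the same place
modulo the period and `a = b`. A factor with no occurrence of `w` in its interior fits, up to a
shift by the period, into the window `w ++ u`. Hence both factors are words of the language, even
though `u ++ u` need not be one.

Two conjugates of `u`, compared lexicographically, first differ after a common prefix `v`, in
letters `c < d`, and their last letters are the letters `a`, `b` that precede them in the repetition
of `u`. So the last letters of the sorted conjugates are sorted for the order of `T.perm.symm`
(`getLast?_rotate_le`), and a sorted rearrangement of the letters of `u` is unique
(`isPermClustering_of_rotate`).
-/

/-! ### The order condition for interval exchanges -/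

namespace IET

variable {A : Type*} [Fintype A] [LinearOrder A]

/-- A partial sum of the lengths up to `a`, for the order pulled back along `f`, is completed by the
length of `a` to at most the partial sum up to any larger letter. -/
theorem sum_len_add_len_le (T : IET A) {B : Type*} [LinearOrder B] (f : A → B) {a b : A}
    (hab : f a < f b) :
    ∑ c with f c < f a, T.len c + T.len a ≤ ∑ c with f c < f b, T.len c := by
  classical
  rw [add_comm, ← Finset.sum_insert (by simp)]
  refine Finset.sum_le_sum_of_subset_of_nonneg (fun c hc => ?_) fun c _ _ => (T.len_pos c).le
  simp only [Finset.mem_insert, Finset.mem_filter, Finset.mem_univ, true_and] at hc ⊢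
  rcases hc with rfl | hc
  · exact hab
  · exact hc.trans hab

theorem lt_of_mem_interval (T : IET A) {a b : A} (hab : a < b) {x y : ℝ}
    (hx : x ∈ T.interval a) (hy : y ∈ T.interval b) : x < y := by
  have h := T.sum_len_add_len_le id hab
  simp only [id] at h
  have h1 := hx.2
  have h2 := hy.1
  simp only [left] at h1 h2
  linarith

theorem eq_of_mem_interval (T : IET A) {a b : A} {x : ℝ}
    (ha : x ∈ T.interval a) (hb : x ∈ T.interval b) : a = b := by
  rcases lt_trichotomy a b with h | h | h
  · exact absurd (T.lt_of_mem_interval h ha hb) (lt_irrefl _)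
  · exact h
  · exact absurd (T.lt_of_mem_interval h hb ha) (lt_irrefl _)

theorem map_of_mem_interval (T : IET A) {a : A} {x : ℝ} (hx : x ∈ T.interval a) :
    T.map x = x + T.shift a := by
  unfold map
  rw [Finset.sum_eq_single a, Set.indicator_of_mem hx]
  · exact fun b _ hb => Set.indicator_of_notMem (fun h => hb (T.eq_of_mem_interval h hx)) _
  · simp

theorem map_lt_map_of_perm_symm_lt (T : IET A) {a b : A} (hab : T.perm.symm a < T.perm.symm b)
    {x y : ℝ} (hx : x ∈ T.interval a) (hy : y ∈ T.interval b) : T.map x < T.map y := by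
  rw [T.map_of_mem_interval hx, T.map_of_mem_interval hy]
  have h := T.sum_len_add_len_le T.perm.symm hab
  have h1 := hx.2
  have h2 := hy.1
  simp only [left] at h1 h2
  simp only [shift]
  linarith

theorem iterate_sub_iterate (T : IET A) (v : ℕ → A) {x y : ℝ} (k : ℕ)
    (hx : ∀ t < k, T.map^[t] x ∈ T.interval (v t))
    (hy : ∀ t < k, T.map^[t] y ∈ T.interval (v t)) :
    T.map^[k] y - T.map^[k] x = y - x := by
  induction k with
  | zero => simp
  | succ k ih =>
    rw [Function.iterate_succ_apply', Function.iterate_succ_apply',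
      T.map_of_mem_interval (hx k k.lt_succ_self), T.map_of_mem_interval (hy k k.lt_succ_self),
      ← ih (fun t ht => hx t (ht.trans k.lt_succ_self)) fun t ht => hy t (ht.trans k.lt_succ_self)]
    ring

/-- The order condition: of two itineraries that agree from time `1` to time `k`, the one with the
smaller letter at time `k + 1` has the smaller first letter for the order of `T.perm.symm`. -/
theorem perm_symm_le_of_itinerary (T : IET A) {x y : ℝ} {r s : ℕ → A} {k : ℕ}
    (hx : ∀ t < k + 2, T.map^[t] x ∈ T.interval (r t))
    (hy : ∀ t < k + 2, T.map^[t] y ∈ T.interval (s t))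
    (hrs : ∀ t < k, r (t + 1) = s (t + 1)) (hlt : r (k + 1) < s (k + 1)) :
    T.perm.symm (r 0) ≤ T.perm.symm (s 0) := by
  by_contra! h
  have h1 : T.map y < T.map x :=
    T.map_lt_map_of_perm_symm_lt h (hy 0 (by omega)) (hx 0 (by omega))
  have h2 : T.map^[k] (T.map x) < T.map^[k] (T.map y) :=
    T.lt_of_mem_interval hlt (hx (k + 1) (by omega)) (hy (k + 1) (by omega))
  have h3 : T.map^[k] (T.map y) - T.map^[k] (T.map x) = T.map y - T.map x :=
    T.iterate_sub_iterate (fun t => r (t + 1)) k (fun t ht => hx (t + 1) (by omega))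
      fun t ht => hrs t ht ▸ hy (t + 1) (by omega)
  linarith

/-- A word of the language is the initial itinerary of some point. -/
theorem exists_itinerary_of_mem_language (T : IET A) {v : List A} (hv : v ∈ T.language) :
    ∃ x, ∀ t (ht : t < v.length), T.map^[t] x ∈ T.interval v[t] := by
  obtain ⟨x, -, s, hs, n, hv⟩ := hv
  refine ⟨T.map^[n] x, fun t ht => ?_⟩
  rw [← Function.iterate_add_apply, ← hs, add_comm t n]
  conv_rhs => rw [List.getElem_of_eq hv]
  simp

end IET

/-! ### Periodic words with one occurrence of a word per period -/

/-- Let `g` have period `n`, let `w` occur in `g` at `n` and at no place strictly between `0` and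
`n`. If `g` has factors of length `k + 2` at the places `p, q < n`, with different first letters and
the same `k` middle letters, then the one at `p` ends before `n + |w|`. -/
theorem window_of_agree {A : Type*} {g : ℕ → A} {n : ℕ} (hg : Function.Periodic g n) {w : List A}
    (hw : ∀ t (ht : t < w.length), g (n + t) = w[t])
    (hno : ∀ e, 0 < e → e < n → ¬ ∀ t (ht : t < w.length), g (e + t) = w[t])
    {p q k : ℕ} (hp : p < n) (hq : q < n) (hpq : g p ≠ g q)
    (hk : ∀ t < k, g (p + (t + 1)) = g (q + (t + 1))) :
    p + (k + 2) ≤ n + w.length := by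
  by_contra! h
  -- Otherwise `w` occurs at `n` among the middle letters, hence also at `q + n - p`.
  have hocc : ∀ t (ht : t < w.length), g (q + n - p + t) = w[t] := by
    intro t ht
    have := hk (n - p + t - 1) (by omega)
    rw [← hw t ht, show n + t = p + (n - p + t - 1 + 1) by omega, this]
    congr 1
    omega
  rcases lt_trichotomy p q with hlt | rfl | hlt
  · refine hno (q - p) (by omega) (by omega) fun t ht => ?_
    rw [← hocc t ht, show q + n - p + t = q - p + t + n by omega, hg]
  · exact hpq rfl
  · exact hno (q + n - p) (by omega) (by omega) hocc

/-! ### The periodic word of a return word -/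

theorem returnWords.getElem_add_length {A : Type*} {L : Set (List A)} {w u : List A}
    (hu : u ∈ returnWords L w) (t : ℕ) (ht : t < w.length) :
    (w ++ u)[u.length + t]'(by simp; omega) = w[t] := by
  obtain ⟨p, hp⟩ := hu.2.2.1
  have hlen : p.length = u.length := by
    have := congrArg List.length hp
    simp only [List.length_append] at this
    omega
  simp [← hp, ← hlen]

/-- The letter at place `t` of the repetition of `u` that extends `w ++ u`. -/
def returnWords.periodicWord {A : Type*} {L : Set (List A)} {w u : List A}
    (hu : u ∈ returnWords L w) (t : ℕ) : A :=
  (w ++ u)[t % u.length]'(by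
    have := Nat.mod_lt t (List.length_pos_of_ne_nil hu.1)
    rw [List.length_append]
    omega)

namespace returnWords

variable {A : Type*} {L : Set (List A)} {w u : List A}

theorem periodicWord_periodic (hu : u ∈ returnWords L w) :
    Function.Periodic (periodicWord hu) u.length := by
  intro t
  simp [periodicWord]

theorem periodicWord_eq_getElem (hu : u ∈ returnWords L w) (t : ℕ) (ht : t < (w ++ u).length) :
    periodicWord hu t = (w ++ u)[t] := by
  induction t using Nat.strong_induction_on with
  | _ t ih =>
    have hn := List.length_pos_of_ne_nil hu.1
    rw [List.length_append] at ht
    rcases lt_or_ge t u.length with h | h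
    · simp only [periodicWord, Nat.mod_eq_of_lt h]
    · obtain ⟨s, rfl⟩ := Nat.exists_eq_add_of_le h
      have hs : s < w.length := by omega
      rw [getElem_add_length hu s hs, add_comm, periodicWord_periodic hu,
        ih s (by omega) (by simp; omega), List.getElem_append_left hs]

theorem periodicWord_add_length (hu : u ∈ returnWords L w) (t : ℕ) (ht : t < w.length) :
    periodicWord hu (u.length + t) = w[t] := by
  rw [periodicWord_eq_getElem hu _ (by simp; omega), getElem_add_length hu t ht]

theorem periodicWord_no_occurrence (hu : u ∈ returnWords L w) (e : ℕ) (he : 0 < e)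
    (hen : e < u.length) : ¬ ∀ t (ht : t < w.length), periodicWord hu (e + t) = w[t] := by
  intro h
  refine hu.2.2.2 ⟨(w ++ u).take e, ((w ++ u).drop e).drop w.length, ?_, ?_, ?_⟩
  · refine List.ne_nil_of_length_pos ?_
    simp
    omega
  · refine List.ne_nil_of_length_pos ?_
    simp
    omega
  · have hw : ((w ++ u).drop e).take w.length = w := by
      refine List.ext_getElem (by simp; omega) fun t _ ht => ?_
      rw [List.getElem_take, List.getElem_drop, ← h t ht, periodicWord_eq_getElem]
    conv_lhs => rw [← List.take_append_drop e (w ++ u),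
      ← List.take_append_drop w.length ((w ++ u).drop e), hw]
    rw [List.append_assoc]

theorem getElem_rotate_eq (hu : u ∈ returnWords L w) (i k : ℕ) (hk : k < (u.rotate i).length) :
    (u.rotate i)[k] = periodicWord hu (w.length + i + k) := by
  have hn := List.length_pos_of_ne_nil hu.1
  have hmod : (k + i) % u.length < u.length := Nat.mod_lt _ hn
  have h := periodicWord_eq_getElem hu (w.length + (k + i) % u.length) (by simp; omega)
  rw [List.getElem_rotate]
  rw [List.getElem_append_right (by omega)] at h
  simp only [Nat.add_sub_cancel_left] at h
  rw [← h, ← (periodicWord_periodic hu).map_mod_nat, Nat.add_mod_mod,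
    (periodicWord_periodic hu).map_mod_nat]
  congr 1
  omega

/-- The last letter of a conjugate is the letter that precedes it in the periodic word. -/
theorem getLast?_rotate_eq (hu : u ∈ returnWords L w) (i : ℕ) :
    (u.rotate i).getLast? = some (periodicWord hu (w.length + i + (u.length - 1))) := by
  have hn := List.length_pos_of_ne_nil hu.1
  rw [List.getLast?_eq_getElem?, List.length_rotate, List.getElem?_eq_getElem (by simp; omega),
    getElem_rotate_eq hu]

end returnWords

/-! ### Clustering from the order of the last letters -/

/-- The last letters of the lexicographically ordered conjugates of a return word to `w` are ordered
by `T.perm.symm`. -/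
theorem getLast?_rotate_le {A : Type*} [Fintype A] [LinearOrder A] (T : IET A) {w u : List A}
    (hu : u ∈ returnWords T.language w) {i j : ℕ} (hij : u.rotate i ≤ u.rotate j) {a b : A}
    (ha : a ∈ (u.rotate i).getLast?) (hb : b ∈ (u.rotate j).getLast?) :
    T.perm.symm a ≤ T.perm.symm b := by
  have hn := List.length_pos_of_ne_nil hu.1
  rcases hij.eq_or_lt with heq | hlt
  · rw [heq] at ha
    rw [Option.mem_unique ha hb]
  rw [List.lt_iff_exists] at hlt
  rcases hlt with ⟨-, h⟩ | ⟨k, h1, h2, hpre, hk⟩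
  · simp at h
  have hk' : k < u.length := by simpa using h1
  rw [returnWords.getLast?_rotate_eq hu, Option.mem_some_iff] at ha hb
  rw [returnWords.getElem_rotate_eq hu, returnWords.getElem_rotate_eq hu] at hk
  have hpre' : ∀ t < k, returnWords.periodicWord hu (w.length + i + t) =
      returnWords.periodicWord hu (w.length + j + t) := by
    intro t ht
    rw [← returnWords.getElem_rotate_eq hu i t (by simp; omega),
      ← returnWords.getElem_rotate_eq hu j t (by simp; omega)]
    exact hpre t ht
  obtain ⟨x, hx⟩ := T.exists_itinerary_of_mem_language hu.2.1
  have hper := returnWords.periodicWord_periodic hu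
  have hocc := returnWords.periodicWord_add_length hu
  have hno := returnWords.periodicWord_no_occurrence hu
  have hx' : ∀ t < (w ++ u).length,
      T.map^[t] x ∈ T.interval (returnWords.periodicWord hu t) := fun t ht => by
    rw [returnWords.periodicWord_eq_getElem hu t ht]
    exact hx t ht
  generalize returnWords.periodicWord hu = g at *
  subst ha hb
  -- `p` and `q` are the places, modulo the period, of the letters that precede the conjugates.
  have hshift : ∀ m t, g ((m + (u.length - 1)) % u.length + (t + 1)) = g (m + t) := by
    intro m t
    rw [← hper.map_mod_nat, Nat.mod_add_mod, hper.map_mod_nat,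
      show m + (u.length - 1) + (t + 1) = m + t + u.length by omega, hper]
  have hp : (w.length + i + (u.length - 1)) % u.length < u.length := Nat.mod_lt _ hn
  have hq : (w.length + j + (u.length - 1)) % u.length < u.length := Nat.mod_lt _ hn
  have hpi := hshift (w.length + i)
  have hqj := hshift (w.length + j)
  rw [← hper.map_mod_nat (w.length + i + _), ← hper.map_mod_nat (w.length + j + _)]
  generalize (w.length + i + (u.length - 1)) % u.length = p at *
  generalize (w.length + j + (u.length - 1)) % u.length = q at *
  by_cases hpq : g p = g q
  · rw [hpq]
  have hagree : ∀ t < k, g (p + (t + 1)) = g (q + (t + 1)) := fun t ht => by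
    rw [hpi, hqj, hpre' t ht]
  have hpw := window_of_agree hper hocc hno hp hq hpq hagree
  have hqw := window_of_agree hper hocc hno hq hp (Ne.symm hpq) fun t ht => (hagree t ht).symm
  refine T.perm_symm_le_of_itinerary (x := T.map^[p] x) (y := T.map^[q] x)
    (r := fun t => g (p + t)) (s := fun t => g (q + t)) (k := k) ?_ ?_ hagree ?_
  · intro t ht
    rw [← Function.iterate_add_apply, add_comm t p]
    exact hx' _ (by simp; omega)
  · intro t ht
    rw [← Function.iterate_add_apply, add_comm t q]
    exact hx' _ (by simp; omega)
  · simpa only [hpi, hqj] using hk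

theorem filterMap_range_getElem? {A : Type*} (v : List A) :
    (List.range v.length).filterMap (fun i => v[i]?) = v := by
  induction v with
  | nil => rfl
  | cons a v ih =>
    rw [List.length_cons, List.range_succ_eq_map, List.filterMap_cons_some (b := a) (by simp),
      List.filterMap_map]
    exact congrArg _ ih

theorem bwt_perm {A : Type*} [LinearOrder A] (u : List A) : (bwt u).Perm u := by
  rcases eq_or_ne u [] with rfl | hu
  · simp [bwt]
  have hn := List.length_pos_of_ne_nil hu
  refine ((List.mergeSort_perm _ _).filterMap _).trans ?_
  have hlast : ∀ i ∈ List.range u.length,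
      (u.rotate i).getLast? = (u.rotate (u.length - 1))[i]? := by
    intro i hi
    have hi := List.mem_range.1 hi
    rw [List.getLast?_eq_getElem?, List.length_rotate, List.getElem?_rotate (by omega),
      List.getElem?_rotate hi, add_comm]
  have heq : ((List.range u.length).map u.rotate).filterMap List.getLast? =
      u.rotate (u.length - 1) := by
    rw [List.filterMap_map]
    refine (List.filterMap_congr hlast).trans ?_
    simpa using filterMap_range_getElem? (u.rotate (u.length - 1))
  rw [heq]
  exact List.rotate_perm _ _

/-- If the last letters of the lexicographically ordered conjugates are ordered by `σ.symm`, then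
the Burrows-Wheeler transform is the rearrangement of the letters that is sorted for that order. -/
theorem isPermClustering_of_rotate {A : Type*} [Fintype A] [LinearOrder A] (σ : Equiv.Perm A)
    {u : List A} (h : ∀ i j, u.rotate i ≤ u.rotate j → ∀ a ∈ (u.rotate i).getLast?,
      ∀ b ∈ (u.rotate j).getLast?, σ.symm a ≤ σ.symm b) :
    IsPermClustering σ u := by
  have hanti : ∀ a b : A, σ.symm a ≤ σ.symm b → σ.symm b ≤ σ.symm a → a = b :=
    fun a b h1 h2 => σ.symm.injective (le_antisymm h1 h2)
  have hsorted : (bwt u).Pairwise fun a b => σ.symm a ≤ σ.symm b := by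
    have hms := List.pairwise_mergeSort (le := fun v v' : List A => decide (v ≤ v'))
      (by simpa using fun a b c : List A => le_trans) (by simpa using le_total)
      ((List.range u.length).map u.rotate)
    refine List.pairwise_filterMap.2 (hms.imp_of_mem fun {v v'} hv hv' hle => ?_)
    obtain ⟨i, -, rfl⟩ := List.mem_map.1 (List.mem_mergeSort.1 hv)
    obtain ⟨j, -, rfl⟩ := List.mem_map.1 (List.mem_mergeSort.1 hv')
    exact fun a ha b hb => h i j (by simpa using hle) a ha b hb
  have huniv : (Finset.univ.sort (fun a b : A => a ≤ b)).Pairwise (· ≤ ·) :=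
    Finset.pairwise_sort _ _
  have hblocks : ((Finset.univ.sort (fun a b : A => a ≤ b)).flatMap
      fun a => List.replicate (u.count (σ a)) (σ a)).Pairwise
        fun a b => σ.symm a ≤ σ.symm b := by
    refine List.pairwise_flatMap.2 ⟨fun a _ => ?_, huniv.imp fun {a b} hab c hc d hd => ?_⟩
    · exact List.pairwise_replicate.2 (Or.inr le_rfl)
    · rw [List.eq_of_mem_replicate hc, List.eq_of_mem_replicate hd]
      simpa using hab
  refine List.Perm.eq_of_pairwise (fun a b _ _ => hanti a b) hsorted hblocks
    ((bwt_perm u).trans (List.perm_iff_count.2 fun b => ?_))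
  rw [List.count_flatMap, ← List.sum_toFinset _ (Finset.sort_nodup _ _), Finset.sort_toFinset,
    Finset.sum_eq_single (σ.symm b)]
  · simp
  · intro a _ ha
    refine List.count_eq_zero.2 fun hb => ha ?_
    rw [List.eq_of_mem_replicate hb, Equiv.symm_apply_apply]
  · simp

theorem theorem1 {A : Type*} [Fintype A] [LinearOrder A] (T : IET A) (hT : T.IsRegular)
    (w : List A) (hw : w ∈ T.language) (u : List A) (hu : u ∈ returnWords T.language w) :
    IsClustering u :=
  ⟨T.perm, isPermClustering_of_rotate T.perm fun _ _ hij _ ha _ hb =>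
    getLast?_rotate_le T hu hij ha hb⟩
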